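/- Let $1\le k\le n$ be integers, let $M_n$ be the algebra of complex $n\times n$ matrices and $M_n^+$ the set of positive semidefinite matrices in $M_n$ (similarly for $M_k\otimes M_n\cong M_{kn}$). Let $\mathrm{Lin}(M_n,M_n)$ be the space of complex linear maps $M_n\to M_n$, with its usual finite-dimensional topology and the Hilbert–Schmidt inner product $\langle R,S\rangle=\mathrm{Tr}(R^*S)$, where $R^*$ is the adjoint of $R$ for the inner product $\langle A,B\rangle=\mathrm{Tr}(A^*B)$ on $M_n$. Let $\mathrm{Lin}(M_n,M_n)^{\mathrm{her}}$ be the real vector space of all $T\in\mathrm{Lin}(M_n,M_n)$ with $T(X^*)=T(X)^*$ for all $X\in M_n$; on it $\langle\cdot,\cdot\rangle$ is real-valued. Define: - $\mathcal P_k$: the set of $k$-positive maps, i.e. all $S\in\mathrm{Lin}(M_n,M_n)$ such that $\mathrm{Id}_{M_k}\otimes S$ maps $(M_k\otimes M_n)^+$ into itself; - $\mathcal S_k$: the set of $k$-superpositive maps, i.e. all $S$ of the form $S(X)=\sum_{i=1}^p L_i^*XL_i$ with $L_1,\dots,L_p\in M_n$ of rank at most $k$; - $\mathcal{EB}_k$: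 the set of $k$-entanglement breaking maps, i.e. all $k$-positive $S$ such that for every $X\in(M_k\otimes M_n)^+$ the matrix $(\mathrm{Id}_{M_k}\otimes S)(X)$ is separable, that is, lies in the closed convex hull of $\{A\otimes B: A\in M_k^+,\ B\in M_n^+\}$; - $\mathcal{EB}_k^\circ=\{R\in\mathrm{Lin}(M_n,M_n)^{\mathrm{her}}:\langle R,S\rangle\ge 0\text{ for all }S\in\mathcal{EB}_k\}$, the dual cone of $\mathcal{EB}_k$. Then each of the sets $C=\mathcal P_k,\ \mathcal S_k,\ \mathcal{EB}_k,\ \mathcal{EB}_k^\circ$ is contained in $\mathrm{Lin}(M_n,M_n)^{\mathrm{her}}$ and is a cone there ($\alpha x+y\in C$ for all $x,y\in C$ and $\alpha\ge 0$) which is closed, pointed ($C\cap(-C)=\{0\}$) and solid (its interior in $\mathrm{Lin}(M_n,M_n)^{\mathrm{her}}$ is nonempty). Moreover each of them is stable under composition: $S\circ T\in C$ for all $S,T\in C$. -/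

import Mathlib

open scoped Matrix Kronecker ComplexOrder

namespace MatrixMapCones

/-- The algebra `M_n` of complex `n × n` matrices. -/
abbrev Mat (n : ℕ) : Type := Matrix (Fin n) (Fin n) ℂ

/-- `Lin(M_n, M_n)`: all complex linear maps from `M_n` to `M_n`. -/
abbrev Lin (n : ℕ) : Type := Mat n →ₗ[ℂ] Mat n

/-- The topology of pointwise convergence on the finite-dimensional space `Lin(M_n, M_n)`. It is a
Hausdorff vector space topology (see the instances below), hence the usual one, induced by any
norm. -/
noncomputable instance instTopologicalSpaceLin (n : ℕ) : TopologicalSpace (Lin n) :=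
  TopologicalSpace.induced (fun S : Lin n => (S : Mat n → Mat n)) inferInstance

instance instIsTopologicalAddGroupLin (n : ℕ) : IsTopologicalAddGroup (Lin n) :=
  topologicalAddGroup_induced (LinearMap.ltoFun ℂ (Mat n) (Mat n) ℂ)

instance instContinuousSMulLin (n : ℕ) : ContinuousSMul ℂ (Lin n) :=
  continuousSMul_induced (LinearMap.ltoFun ℂ (Mat n) (Mat n) ℂ)

instance instContinuousSMulRealLin (n : ℕ) : ContinuousSMul ℝ (Lin n) :=
  IsScalarTower.continuousSMul ℂ

instance instT2SpaceLin (n : ℕ) : T2Space (Lin n) :=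
  T2Space.of_injective_continuous (f := fun S : Lin n => (S : Mat n → Mat n))
    DFunLike.coe_injective continuous_induced_dom

/-- `Lin(M_n, M_n)^her`: the real vector space of hermitianity preserving maps, `T(X*) = T(X)*`. -/
def LinHer (n : ℕ) : Submodule ℝ (Lin n) where
  carrier := {T | ∀ X : Mat n, T Xᴴ = (T X)ᴴ}
  add_mem' := by
    intro S T hS hT X
    simp [hS X, hT X]
  zero_mem' := by
    intro X
    simp
  smul_mem' := by
    intro c T hT X
    simp [hT X, Matrix.conjTranspose_smul]

/-! ### Cones in a real topological vector space -/

section Cones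

variable {V : Type*} [AddCommGroup V] [Module ℝ V]

/-- A cone: `α x + y ∈ C` for all `x, y ∈ C` and `α ≥ 0`. -/
def IsCone (C : Set V) : Prop :=
  ∀ x ∈ C, ∀ y ∈ C, ∀ α : ℝ, 0 ≤ α → α • x + y ∈ C

/-- A pointed cone: `C ∩ (-C) = {0}`. -/
def IsPointed (C : Set V) : Prop :=
  C ∩ {x | -x ∈ C} = {0}

/-- A solid cone: the interior is nonempty. -/
def IsSolid [TopologicalSpace V] (C : Set V) : Prop :=
  (interior C).Nonempty

end Cones

/-! ### The Hilbert-Schmidt inner product and dual cones -/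

/-- The adjoint `S*` of `S ∈ Lin(M_n, M_n)` with respect to the Hilbert-Schmidt inner product
`⟨A, B⟩ = Tr(A* B)` on `M_n`; its entries are `S*(A)_{ij} = ⟨E_{ij}, S*(A)⟩ = ⟨S(E_{ij}), A⟩`. -/
noncomputable def hsAdjoint {n : ℕ} (S : Lin n) : Lin n where
  toFun A := Matrix.of fun i j => ((S (Matrix.single i j 1))ᴴ * A).trace
  map_add' A B := by
    ext i j
    simp [Matrix.mul_add]
  map_smul' c A := by
    ext i j
    simp

/-- The defining property of the adjoint: `⟨S*(A), B⟩ = ⟨A, S(B)⟩`. -/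
theorem hsAdjoint_spec {n : ℕ} (S : Lin n) (A B : Mat n) :
    ((hsAdjoint S A)ᴴ * B).trace = (Aᴴ * S B).trace := by
  have h1 : S B = ∑ i, ∑ j, B i j • S (Matrix.single i j 1) := by
    conv_lhs => rw [Matrix.matrix_eq_sum_single B]
    simp only [map_sum]
    refine Finset.sum_congr rfl fun i _ => Finset.sum_congr rfl fun j _ => ?_
    rw [← map_smul, Matrix.smul_single, smul_eq_mul, mul_one]
  have h2 : ∀ i j, star (hsAdjoint S A i j) = (Aᴴ * S (Matrix.single i j 1)).trace := by
    intro i j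
    change star ((S (Matrix.single i j 1))ᴴ * A).trace = _
    rw [← Matrix.trace_conjTranspose, Matrix.conjTranspose_mul, Matrix.conjTranspose_conjTranspose]
  rw [h1]
  simp only [Matrix.mul_sum, Matrix.trace_sum, Matrix.mul_smul, Matrix.trace_smul, ← h2,
    smul_eq_mul]
  simp only [Matrix.trace, Matrix.diag_apply, Matrix.mul_apply, Matrix.conjTranspose_apply]
  rw [Finset.sum_comm]
  exact Finset.sum_congr rfl fun i _ => Finset.sum_congr rfl fun j _ => mul_comm _ _

/-- The Hilbert-Schmidt inner product `⟨R, S⟩ = Tr(R* S)` on `Lin(M_n, M_n)`. -/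
noncomputable def hsInner {n : ℕ} (R S : Lin n) : ℂ :=
  LinearMap.trace ℂ (Mat n) (hsAdjoint R ∘ₗ S)

theorem hsInner_eq_sum {n : ℕ} (R S : Lin n) :
    hsInner R S =
      ∑ i, ∑ j, ((R (Matrix.single i j 1))ᴴ * S (Matrix.single i j 1)).trace := by
  rw [hsInner, LinearMap.trace_eq_matrix_trace ℂ (Matrix.stdBasis ℂ (Fin n) (Fin n)), Matrix.trace,
    Fintype.sum_prod_type]
  refine Finset.sum_congr rfl fun i _ => Finset.sum_congr rfl fun j _ => ?_
  rw [Matrix.diag_apply, LinearMap.toMatrix_apply, Matrix.stdBasis_eq_single]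
  rfl

/-- On hermitianity preserving maps the Hilbert-Schmidt inner product is real. -/
theorem hsInner_im {n : ℕ} {R S : Lin n} (hR : R ∈ LinHer n) (hS : S ∈ LinHer n) :
    (hsInner R S).im = 0 := by
  rw [← Complex.conj_eq_iff_im, hsInner_eq_sum, map_sum, Finset.sum_comm]
  refine Finset.sum_congr rfl fun i _ => ?_
  rw [map_sum]
  refine Finset.sum_congr rfl fun j _ => ?_
  have hE : (Matrix.single j i (1 : ℂ))ᴴ = Matrix.single i j 1 := by simp
  rw [starRingEnd_apply, ← Matrix.trace_conjTranspose, Matrix.conjTranspose_mul,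
    Matrix.conjTranspose_conjTranspose, ← hE, hR, hS, Matrix.conjTranspose_conjTranspose,
    Matrix.trace_mul_comm]

/-- The dual cone in `Lin(M_n, M_n)^her` of a set `C` of hermitianity preserving maps, where
`Lin(M_n, M_n)^her` is identified with its dual space by the (real-valued) Hilbert-Schmidt inner
product: all `R` with `⟨R, S⟩ ≥ 0` for every `S ∈ C`. -/
def dualCone {n : ℕ} (C : Set (Lin n)) : Set (Lin n) :=
  {R | R ∈ LinHer n ∧ ∀ S ∈ C, 0 ≤ (hsInner R S).re}

/-! ### `k`-positive, `k`-superpositive and `k`-entanglement breaking maps -/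

/-- `M_k ⊗ M_n`, realised by block matrices: the elementary tensor `A ⊗ B` is the Kronecker product
`A ⊗ₖ B`. -/
abbrev TMat (k n : ℕ) : Type := Matrix (Fin k × Fin n) (Fin k × Fin n) ℂ

/-- The map `Id_{M_k} ⊗ S` on `M_k ⊗ M_n`: it applies `S` to each of the `k × k` blocks. -/
def ampl (k : ℕ) {n : ℕ} (S : Lin n) : TMat k n →ₗ[ℂ] TMat k n where
  toFun X := Matrix.of fun p q => S (Matrix.of fun i j => X (p.1, i) (q.1, j)) p.2 q.2
  map_add' X Y := by
    ext p q
    exact congrFun (congrFun (S.map_add (Matrix.of fun i j => X (p.1, i) (q.1, j))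
      (Matrix.of fun i j => Y (p.1, i) (q.1, j))) p.2) q.2
  map_smul' c X := by
    ext p q
    exact congrFun (congrFun (S.map_smul c (Matrix.of fun i j => X (p.1, i) (q.1, j))) p.2) q.2

theorem ampl_kronecker (k : ℕ) {n : ℕ} (S : Lin n) (A : Mat k) (B : Mat n) :
    ampl k S (A ⊗ₖ B) = A ⊗ₖ S B := by
  ext p q
  exact congrFun (congrFun (S.map_smul (A p.1 q.1) B) p.2) q.2

/-- `S` is `k`-positive: `Id_{M_k} ⊗ S` maps positive matrices to positive matrices. -/
def IsKPositive (k : ℕ) {n : ℕ} (S : Lin n) : Prop :=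
  ∀ X : TMat k n, X.PosSemidef → (ampl k S X).PosSemidef

/-- `S` is `k`-superpositive: it has a Kraus representation `S(X) = ∑ᵢ Lᵢ* X Lᵢ` in which all the
`Lᵢ` have rank at most `k`. -/
def IsKSuperpositive (k : ℕ) {n : ℕ} (S : Lin n) : Prop :=
  ∃ (p : ℕ) (L : Fin p → Mat n), (∀ i, (L i).rank ≤ k) ∧
    ∀ X : Mat n, S X = ∑ i, (L i)ᴴ * X * L i

/-- `X ∈ M_k ⊗ M_n` is separable: it lies in the closed convex hull of `M_k⁺ ⊗ M_n⁺`. -/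
def IsSeparable {k n : ℕ} (X : TMat k n) : Prop :=
  X ∈ closedConvexHull ℝ
    {Y : TMat k n | ∃ (A : Mat k) (B : Mat n), A.PosSemidef ∧ B.PosSemidef ∧ Y = A ⊗ₖ B}

/-- `S` is `k`-entanglement breaking: it is `k`-positive and `(Id_{M_k} ⊗ S)(X)` is separable for
every positive `X ∈ M_k ⊗ M_n`. -/
def IsKEntanglementBreaking (k : ℕ) {n : ℕ} (S : Lin n) : Prop :=
  IsKPositive k S ∧ ∀ X : TMat k n, X.PosSemidef → IsSeparable (ampl k S X)

/-- The cone `P_k` of `k`-positive maps on `M_n`. -/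
def coneP (n k : ℕ) : Set (Lin n) := {S | IsKPositive k S}

/-- The cone `S_k` of `k`-superpositive maps on `M_n`. -/
def coneS (n k : ℕ) : Set (Lin n) := {S | IsKSuperpositive k S}

/-- The cone `EB_k` of `k`-entanglement breaking maps on `M_n`. -/
def coneEB (n k : ℕ) : Set (Lin n) := {S | IsKEntanglementBreaking k S}

/-- The part of a set `C` of linear maps in `Lin(M_n, M_n)^her`, as a subset of that real
topological vector space. -/
def inHer {n : ℕ} (C : Set (Lin n)) : Set (LinHer n) := {T | (T : Lin n) ∈ C}

end MatrixMapCones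

/-!
All four cones lie between two simple ones, and this settles everything but closedness and
stability under composition. They contain the maps `X ↦ Tr(A X) B` with `A`, `B` positive
semidefinite (`measurePrepare`), and they consist of positive maps (`IsPositiveMap`). Positive maps
preserve hermiticity, and a map `S` with `S` and `-S` positive vanishes on the positive semidefinite
matrices, which span; so the cones are hermitian and pointed. The maps `X ↦ Tr(A X) B` span the
real space of all hermitianity preserving maps (`mem_span_measurePrepare`), and a cone containing a
spanning set has interior points (`IsCone.isSolid_of_span_eq_top`); so the cones are solid. For the
dual cone `EB_k°` both inclusions come from `⟨S, Tr(A ·) B⟩ = Tr(S(A) B)`.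

The cones `P_k`, `EB_k` and `EB_k°` are intersections of closed conditions. The cone `S_k` is
generated by the set of maps `X ↦ Lᴴ X L` with `L` of rank at most `k` and Hilbert-Schmidt norm
`1`. This set is compact, since the rank is lower semicontinuous, and the functional `S ↦ Tr S(1)`
equals `1` on it. By Carathéodory's theorem its convex hull is compact, so the cone is closed
(`isClosed_coneS`).

For composition, a hermitian `X ∈ M_k ⊗ M_n` is separable exactly when all block positive
functionals `g` are nonnegative on it (`IsSeparable.of_forall_nonneg`). Positive maps preserve
separability, so `EB_k` is stable under composition with positive maps from the left. For
`R, T ∈ EB_k°` and `S ∈ EB_k` one has `⟨R ∘ T, S⟩ = ⟨R, S ∘ T*⟩`, so it suffices that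
`S ∘ T*` lies in `EB_k`. Given `X ≥ 0` and a block positive `g`, there is a positive map `P` with
`g((Id ⊗ Q)(X)) = Tr(P ∘ Q)` for all `Q` (`pairingMap`), and for `Q = S ∘ T*` this trace is
`Tr(T* ∘ P ∘ S) = ⟨T, P ∘ S⟩`, which has nonnegative real part as `P ∘ S ∈ EB_k`.
-/

namespace MatrixMapCones

/-! ### Positive semidefinite matrices -/

/-- Over `ℂ` the hermiticity of `M` is a consequence of the nonnegativity of its quadratic form. -/
theorem posSemidef_of_forall_nonneg {m : Type*} [Fintype m] [DecidableEq m]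
    {M : Matrix m m ℂ}
    (h : ∀ x : m → ℂ, 0 ≤ star x ⬝ᵥ (M *ᵥ x)) : M.PosSemidef := by
  rw [← Matrix.isPositive_toEuclideanLin_iff, LinearMap.isPositive_iff_complex]
  intro x
  have hx : inner ℂ (M.toEuclideanLin x) x = star (star x.ofLp ⬝ᵥ (M *ᵥ x.ofLp)) := by
    rw [EuclideanSpace.inner_eq_star_dotProduct, Matrix.ofLp_toLpLin, Matrix.toLin'_apply,
      ← Matrix.star_dotProduct_star, star_star, dotProduct_comm]
  have h0 := h x.ofLp
  rw [hx, (IsSelfAdjoint.of_nonneg h0).star_eq]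
  exact ⟨Complex.ext rfl (Complex.nonneg_iff.1 h0).2, (Complex.nonneg_iff.1 h0).1⟩

open scoped MatrixOrder in
theorem exists_eq_conjTranspose_mul_self {m : Type*} [Fintype m] [DecidableEq m]
    {A : Matrix m m ℂ} (hA : A.PosSemidef) :
    ∃ C : Matrix m m ℂ, A = Cᴴ * C :=
  CStarAlgebra.nonneg_iff_eq_star_mul_self.1 hA.nonneg

open scoped MatrixOrder in
theorem eq_zero_of_posSemidef_neg {m : Type*} {A : Matrix m m ℂ} (h : A.PosSemidef)
    (h' : (-A).PosSemidef) :
    A = 0 :=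
  le_antisymm (neg_nonneg.1 h'.nonneg) h.nonneg

theorem exists_eq_sub_posSemidef {m : Type*} [Fintype m] [DecidableEq m]
    {A : Matrix m m ℂ} (hA : A.IsHermitian) :
    ∃ B C : Matrix m m ℂ, B.PosSemidef ∧ C.PosSemidef ∧ A = B - C := by
  -- `A = ((A + 1)² - (A - 1)²) / 4`
  refine ⟨(4⁻¹ : ℝ) • ((A + 1)ᴴ * (A + 1)), (4⁻¹ : ℝ) • ((A - 1)ᴴ * (A - 1)), ?_, ?_, ?_⟩
  · exact (Matrix.posSemidef_conjTranspose_mul_self _).smul (by norm_num)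
  · exact (Matrix.posSemidef_conjTranspose_mul_self _).smul (by norm_num)
  · rw [← smul_sub, Matrix.conjTranspose_add, Matrix.conjTranspose_sub, hA.eq,
      Matrix.conjTranspose_one]
    have : (A + 1) * (A + 1) - (A - 1) * (A - 1) = (4 : ℝ) • A := by
      have : (4 : ℝ) • A = A + A + A + A := by module
      rw [this]; noncomm_ring
    rw [this, smul_smul]; norm_num

theorem exists_eq_add_I_smul {m : Type*} (X : Matrix m m ℂ) :
    ∃ A B : Matrix m m ℂ, A.IsHermitian ∧ B.IsHermitian ∧ X = A + Complex.I • B := by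
  refine ⟨(2⁻¹ : ℂ) • (X + Xᴴ), (-Complex.I / 2) • (X - Xᴴ), ?_, ?_, ?_⟩
  · simp [Matrix.IsHermitian, Matrix.conjTranspose_smul, add_comm]
  · simp only [Matrix.IsHermitian, Matrix.conjTranspose_smul, Matrix.conjTranspose_sub,
      Matrix.conjTranspose_conjTranspose]
    rw [← neg_sub X, smul_neg, ← neg_smul]
    congr 1
    simp
    ring
  · rw [smul_smul, show Complex.I * (-Complex.I / 2) = 2⁻¹ by
      linear_combination (-1 / 2 : ℂ) * Complex.I_mul_I]
    module

theorem trace_mul_nonneg {m : Type*} [Fintype m] [DecidableEq m]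
    {A B : Matrix m m ℂ} (hA : A.PosSemidef) (hB : B.PosSemidef) :
    0 ≤ (A * B).trace := by
  obtain ⟨C, rfl⟩ := exists_eq_conjTranspose_mul_self hB
  rw [← Matrix.mul_assoc, Matrix.trace_mul_comm, ← Matrix.mul_assoc]
  exact (hA.mul_mul_conjTranspose_same C).trace_nonneg

theorem trace_mul_vecMulVec_star {m : Type*} [Fintype m] (A : Matrix m m ℂ) (x : m → ℂ) :
    (A * Matrix.vecMulVec x (star x)).trace = star x ⬝ᵥ (A *ᵥ x) := by
  rw [Matrix.mul_vecMulVec, Matrix.trace_vecMulVec, dotProduct_comm]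

theorem isClosed_posSemidef {m : Type*} [Fintype m] [DecidableEq m] :
    IsClosed {A : Matrix m m ℂ | A.PosSemidef} := by
  have : {A : Matrix m m ℂ | A.PosSemidef} =
      ⋂ x : m → ℂ, {A | 0 ≤ star x ⬝ᵥ (A *ᵥ x)} := by
    ext A
    simp only [Set.mem_ofPred_eq, Set.mem_iInter]
    exact ⟨fun h x => h.dotProduct_mulVec_nonneg x, posSemidef_of_forall_nonneg⟩
  rw [this]
  refine isClosed_iInter fun x => ?_
  exact isClosed_le continuous_const (by fun_prop)

/-! ### Positive maps -/

/-- `S` is positive: it maps positive semidefinite matrices to positive semidefinite matrices. -/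
def IsPositiveMap {n : ℕ} (S : Lin n) : Prop :=
  ∀ A : Mat n, A.PosSemidef → (S A).PosSemidef

theorem IsPositiveMap.mem_linHer {n : ℕ} {S : Lin n} (hS : IsPositiveMap S) : S ∈ LinHer n := by
  have hH : ∀ A : Mat n, A.IsHermitian → (S A)ᴴ = S A := by
    intro A hA
    obtain ⟨B, C, hB, hC, rfl⟩ := exists_eq_sub_posSemidef hA
    rw [map_sub, Matrix.conjTranspose_sub, (hS B hB).isHermitian.eq, (hS C hC).isHermitian.eq]
  intro X
  obtain ⟨A, B, hA, hB, rfl⟩ := exists_eq_add_I_smul X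
  rw [Matrix.conjTranspose_add, Matrix.conjTranspose_smul, hA.eq, hB.eq, map_add, map_add,
    map_smul, map_smul, Matrix.conjTranspose_add, Matrix.conjTranspose_smul, hH A hA, hH B hB]

theorem eq_zero_of_isPositiveMap_neg {n : ℕ} {S : Lin n} (h : IsPositiveMap S)
    (h' : IsPositiveMap (-S)) : S = 0 := by
  have hP : ∀ A : Mat n, A.PosSemidef → S A = 0 := fun A hA =>
    eq_zero_of_posSemidef_neg (h A hA) (h' A hA)
  have hH : ∀ A : Mat n, A.IsHermitian → S A = 0 := by
    intro A hA
    obtain ⟨B, C, hB, hC, rfl⟩ := exists_eq_sub_posSemidef hA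
    rw [map_sub, hP B hB, hP C hC, sub_zero]
  ext1 X
  obtain ⟨A, B, hA, hB, rfl⟩ := exists_eq_add_I_smul X
  rw [map_add, map_smul, hH A hA, hH B hB, smul_zero, add_zero, LinearMap.zero_apply]

theorem IsKPositive.isPositiveMap {n k : ℕ} (hk : 1 ≤ k) {S : Lin n} (hS : IsKPositive k S) :
    IsPositiveMap S := by
  intro A hA
  have h := hS ((1 : Mat k) ⊗ₖ A) (Matrix.PosSemidef.one.kronecker hA)
  rw [ampl_kronecker] at h
  convert h.submatrix fun i => ((⟨0, hk⟩ : Fin k), i) using 1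
  ext i j
  simp

theorem IsKSuperpositive.isPositiveMap {n k : ℕ} {S : Lin n} (hS : IsKSuperpositive k S) :
    IsPositiveMap S := by
  obtain ⟨p, L, -, hL⟩ := hS
  intro A hA
  rw [hL]
  exact Matrix.posSemidef_sum _ fun i _ => hA.conjTranspose_mul_mul_same (L i)

/-! ### Measure-and-prepare maps -/

/-- The map `X ↦ Tr(A X) B`. For positive semidefinite `A` and `B` these maps generate a cone that
lies in all the cones under study. -/
noncomputable def measurePrepare {n : ℕ} (A B : Mat n) : Lin n :=
  (Matrix.traceLinearMap (Fin n) ℂ ℂ ∘ₗ LinearMap.mulLeft ℂ A).smulRight B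

@[simp]
theorem measurePrepare_apply {n : ℕ} (A B X : Mat n) :
    measurePrepare A B X = (A * X).trace • B := rfl

theorem isKSuperpositive_measurePrepare {n k : ℕ} (hk : 1 ≤ k) {A B : Mat n} (hA : A.PosSemidef)
    (hB : B.PosSemidef) : IsKSuperpositive k (measurePrepare A B) := by
  obtain ⟨M, rfl⟩ := exists_eq_conjTranspose_mul_self hA
  obtain ⟨N, rfl⟩ := exists_eq_conjTranspose_mul_self hB
  -- For `A = Mᴴ M` and `B = Nᴴ N` the Kraus operators are `Mᴴ Eᵢⱼ N`, of rank at most one.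
  let K : Fin n × Fin n → Mat n := fun q => Mᴴ * Matrix.single q.1 q.2 1 * N
  have hK : ∀ X : Mat n, measurePrepare (Mᴴ * M) (Nᴴ * N) X = ∑ q, (K q)ᴴ * X * K q := by
    intro X
    have h : ∀ q, (K q)ᴴ * X * K q =
        Nᴴ * (Matrix.single q.2 q.1 1 * (M * X * Mᴴ) * Matrix.single q.1 q.2 1) * N := by
      intro q
      simp [K, Matrix.conjTranspose_mul, Matrix.mul_assoc]
    have h2 : ∑ q : Fin n × Fin n,
        Matrix.single q.2 q.1 1 * (M * X * Mᴴ) * Matrix.single q.1 q.2 1 =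
          (M * X * Mᴴ).trace • (1 : Mat n) := by
      simp only [Matrix.single_mul_mul_single, one_mul, mul_one]
      rw [Fintype.sum_prod_type, Matrix.trace, Finset.sum_smul]
      refine Finset.sum_congr rfl fun i _ => ?_
      ext a b
      rcases eq_or_ne a b with rfl | hab
      · simp [Matrix.sum_apply, Matrix.single_apply]
      · simp [Matrix.sum_apply, Matrix.single_apply, hab]
        refine Finset.sum_eq_zero fun c _ => if_neg ?_
        rintro ⟨rfl, rfl⟩
        exact hab rfl
    simp_rw [h]
    rw [← Finset.sum_mul, ← Finset.mul_sum, h2, measurePrepare_apply, Matrix.mul_assoc Mᴴ M X,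
      Matrix.trace_mul_comm]
    simp
  refine ⟨_, fun i => K (Fintype.equivFin _ |>.symm i), fun i => ?_, fun X => ?_⟩
  · refine ((Matrix.rank_mul_le_left _ _).trans (Matrix.rank_mul_le_right _ _)).trans ?_
    rw [Matrix.single_eq_single_vecMulVec_single]
    exact (Matrix.rank_vecMulVec_le _ _).trans hk
  · rw [hK]
    exact (Equiv.sum_comp _ fun q => (K q)ᴴ * X * K q).symm

/-- Write the matrix units as `Eᵢⱼ = Pᵢⱼ - i Qᵢⱼ` with `Pᵢⱼ` and `Qᵢⱼ` hermitian. Applying `T` to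
`X = ∑ᵢⱼ Tr(Pᵢⱼ X) Pᵢⱼ + Tr(Qᵢⱼ X) Qᵢⱼ` writes `T` as a sum of maps `X ↦ Tr(A X) B` with `A`, `B`
hermitian, and a hermitian matrix is a difference of two positive semidefinite ones. -/
theorem mem_span_measurePrepare {n : ℕ} {T : Lin n} (hT : T ∈ LinHer n) :
    T ∈ Submodule.span ℝ
      {S : Lin n | ∃ A B : Mat n, A.PosSemidef ∧ B.PosSemidef ∧ S = measurePrepare A B} := by
  set V := Submodule.span ℝ
      {S : Lin n | ∃ A B : Mat n, A.PosSemidef ∧ B.PosSemidef ∧ S = measurePrepare A B}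
  have hher : ∀ A B : Mat n, A.IsHermitian → B.IsHermitian → measurePrepare A B ∈ V := by
    intro A B hA hB
    obtain ⟨A₁, A₂, hA₁, hA₂, rfl⟩ := exists_eq_sub_posSemidef hA
    obtain ⟨B₁, B₂, hB₁, hB₂, rfl⟩ := exists_eq_sub_posSemidef hB
    have : measurePrepare (A₁ - A₂) (B₁ - B₂) =
        (measurePrepare A₁ B₁ - measurePrepare A₁ B₂) -
          (measurePrepare A₂ B₁ - measurePrepare A₂ B₂) := by
      ext1 X
      simp [sub_mul, sub_smul, smul_sub]
      abel
    rw [this]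
    exact V.sub_mem
      (V.sub_mem (Submodule.subset_span ⟨_, _, hA₁, hB₁, rfl⟩)
        (Submodule.subset_span ⟨_, _, hA₁, hB₂, rfl⟩))
      (V.sub_mem (Submodule.subset_span ⟨_, _, hA₂, hB₁, rfl⟩)
        (Submodule.subset_span ⟨_, _, hA₂, hB₂, rfl⟩))
  let P : Fin n → Fin n → Mat n := fun i j =>
    (2⁻¹ : ℂ) • (Matrix.single i j 1 + Matrix.single j i 1)
  let Q : Fin n → Fin n → Mat n := fun i j =>
    (Complex.I / 2) • (Matrix.single i j 1 - Matrix.single j i 1)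
  have hP : ∀ i j, (P i j).IsHermitian := by
    intro i j
    simp [P, Matrix.IsHermitian, add_comm]
  have hQ : ∀ i j, (Q i j).IsHermitian := by
    intro i j
    simp only [Q, Matrix.IsHermitian, Matrix.conjTranspose_smul, Matrix.conjTranspose_sub,
      Matrix.conjTranspose_single, star_one]
    rw [← neg_sub, smul_neg, ← neg_smul]
    congr 1
    simp
    ring
  have key : ∀ X : Mat n, X =
      ∑ i, ∑ j, ((P i j * X).trace • P i j + (Q i j * X).trace • Q i j) := by
    intro X
    have h : ∀ i j, (P i j * X).trace • P i j + (Q i j * X).trace • Q i j =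
        (2⁻¹ : ℂ) • (Matrix.single i j (X i j) + Matrix.single j i (X j i)) := by
      intro i j
      have e : ∀ a b, (Matrix.single a b 1 * X).trace = X b a := by
        intro a b; simp [Matrix.trace_single_mul]
      have s : ∀ a b, Matrix.single a b (X a b) = X a b • (Matrix.single a b 1 : Mat n) := by
        intro a b; simp
      simp only [P, Q, Matrix.smul_mul, Matrix.add_mul, Matrix.sub_mul, Matrix.trace_smul,
        Matrix.trace_add, Matrix.trace_sub, e, s, smul_eq_mul]
      match_scalars
      · linear_combination (4⁻¹ : ℂ) * (X j i - X i j) * Complex.I_mul_I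
      · linear_combination (4⁻¹ : ℂ) * (X i j - X j i) * Complex.I_mul_I
    simp_rw [h, ← Finset.smul_sum, Finset.sum_add_distrib]
    rw [Finset.sum_comm (f := fun i j => Matrix.single j i (X j i)),
      ← Matrix.matrix_eq_sum_single X]
    module
  have hTP : T = ∑ i, ∑ j, (measurePrepare (P i j) (T (P i j)) +
      measurePrepare (Q i j) (T (Q i j))) := by
    ext1 X
    conv_lhs => rw [key X]
    simp [LinearMap.sum_apply]
  have hTH : ∀ A : Mat n, A.IsHermitian → (T A).IsHermitian := fun A hA => by
    rw [Matrix.IsHermitian, ← hT, hA.eq]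
  rw [hTP]
  exact V.sum_mem fun i _ => V.sum_mem fun j _ =>
    V.add_mem (hher _ _ (hP i j) (hTH _ (hP i j))) (hher _ _ (hQ i j) (hTH _ (hQ i j)))

/-! ### Convex sets in finite-dimensional spaces -/

section Convex

variable {V : Type*} [AddCommGroup V] [Module ℝ V]

theorem IsCone.sum_smul_mem {C : Set V} (hC : IsCone C) (h0 : (0 : V) ∈ C) {ι : Type*}
    (s : Finset ι) (c : ι → ℝ) (x : ι → V) (hc : ∀ i ∈ s, 0 ≤ c i) (hx : ∀ i ∈ s, x i ∈ C) :
    ∑ i ∈ s, c i • x i ∈ C := by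
  classical
  induction s using Finset.induction_on with
  | empty => simpa using h0
  | insert i s hi ih =>
    rw [Finset.sum_insert hi]
    exact hC _ (hx i (by simp)) _ (ih (fun j hj => hc j (by simp [hj]))
      fun j hj => hx j (by simp [hj])) _ (hc i (by simp))

variable [TopologicalSpace V] [IsTopologicalAddGroup V] [ContinuousSMul ℝ V]

/-- A cone with a spanning subset contains the open orthant of a basis of `V`. -/
theorem IsCone.isSolid_of_span_eq_top [T2Space V] [FiniteDimensional ℝ V] {C E : Set V}
    (hC : IsCone C) (h0 : (0 : V) ∈ C) (hEC : E ⊆ C) (hE : Submodule.span ℝ E = ⊤) :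
    IsSolid C := by
  let b := Module.Basis.ofSpan hE.ge
  have hb : ∀ i, b i ∈ C := fun i => hEC <| by
    have h : b i = (i : V) := Module.Basis.ofSpan_apply_self hE.ge i
    rw [h]
    exact (linearIndepOn_empty ℝ id).extend_subset _ i.2
  have : Fintype _ := FiniteDimensional.fintypeBasisIndex b
  let e := b.equivFun.toContinuousLinearEquiv
  refine ⟨e.symm 1, mem_interior.2 ⟨e ⁻¹' Set.univ.pi fun _ => Set.Ioi 0, fun x hx => ?_,
    (isOpen_set_pi Set.finite_univ fun _ _ => isOpen_Ioi).preimage e.continuous, ?_⟩⟩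
  · rw [← b.sum_equivFun x]
    exact hC.sum_smul_mem h0 _ _ _ (fun i _ => (hx i (Set.mem_univ i)).le) fun i _ => hb i
  · simp

theorem isCompact_convexJoin {s t : Set V} (hs : IsCompact s) (ht : IsCompact t) :
    IsCompact (convexJoin ℝ s t) := by
  have : convexJoin ℝ s t =
      (fun p : ℝ × V × V => (1 - p.1) • p.2.1 + p.1 • p.2.2) '' (Set.Icc 0 1 ×ˢ s ×ˢ t) := by
    ext x
    simp only [mem_convexJoin, segment_eq_image, Set.mem_image, Set.mem_prod, Prod.exists]
    constructor
    · rintro ⟨a, ha, b, hb, θ, hθ, rfl⟩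
      exact ⟨θ, a, b, ⟨hθ, ha, hb⟩, rfl⟩
    · rintro ⟨θ, a, b, ⟨hθ, ha, hb⟩, rfl⟩
      exact ⟨a, ha, b, hb, θ, hθ, rfl⟩
  rw [this]
  exact (isCompact_Icc.prod (hs.prod ht)).image (by fun_prop)

/-- By Carathéodory's theorem boundedly many iterated joins of `K` exhaust its convex hull. -/
theorem isCompact_convexHull [FiniteDimensional ℝ V] {K : Set V} (hK : IsCompact K) :
    IsCompact (convexHull ℝ K) := by
  classical
  let J : ℕ → Set V := fun m => (convexJoin ℝ K)^[m] K
  have hJs : ∀ m, J (m + 1) = convexJoin ℝ K (J m) := fun m => Function.iterate_succ_apply' _ _ _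
  have hJc : ∀ m, IsCompact (J m) := by
    intro m
    induction m with
    | zero => exact hK
    | succ m ih => rw [hJs]; exact isCompact_convexJoin hK ih
  have hJle : ∀ m, J m ⊆ convexHull ℝ K := by
    intro m
    induction m with
    | zero => exact subset_convexHull ℝ K
    | succ m ih =>
      rw [hJs]
      exact convexJoin_subset (subset_convexHull ℝ K) ih (convex_convexHull ℝ K)
  have hJge : ∀ m, ∀ t : Finset V, t.card = m + 1 → (t : Set V) ⊆ K →
      convexHull ℝ (t : Set V) ⊆ J m := by
    intro m
    induction m with
    | zero =>
      intro t ht htK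
      obtain ⟨a, rfl⟩ := Finset.card_eq_one.1 ht
      simpa [J] using htK
    | succ m ih =>
      intro t ht htK
      obtain ⟨a, u, hau, rfl, hu⟩ := Finset.card_eq_succ.1 ht
      rw [Finset.coe_insert] at htK ⊢
      rw [convexHull_insert (by exact_mod_cast Finset.card_pos.1 (by omega)), hJs]
      exact convexJoin_mono (by simpa using htK (Set.mem_insert a _))
        (ih u hu fun x hx => htK (Set.mem_insert_of_mem a hx))
  have : convexHull ℝ K = ⋃ m ∈ Finset.range (Module.finrank ℝ V + 1), J m := by
    refine subset_antisymm ?_ (Set.iUnion₂_subset fun m _ => hJle m)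
    rw [convexHull_eq_union]
    refine Set.iUnion_subset fun t => Set.iUnion₂_subset fun htK ht x hx => ?_
    have hpos : 0 < t.card := by
      rw [Finset.card_pos, ← Finset.coe_nonempty]
      exact convexHull_nonempty_iff.1 ⟨x, hx⟩
    have hcard : t.card ≤ Module.finrank ℝ V + 1 := by
      have h := ht.card_le_finrank_succ
      rw [Fintype.card_coe] at h
      exact h.trans (Nat.succ_le_succ (Submodule.finrank_le _))
    simp only [Set.mem_iUnion, Finset.mem_range]
    exact ⟨t.card - 1, by omega, hJge _ t (by omega) htK hx⟩
  rw [this]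
  exact (Finset.range _).isCompact_biUnion fun m _ => hJc m

/-- If a homogeneous continuous `φ` equals `1` on the convex hull of a compact set `K`, then the cone
generated by `K` is closed: its part `φ < M` lies in the compact set `[0, M] • convexHull K`. -/
theorem isClosed_cone_of_compact [T2Space V] [FiniteDimensional ℝ V] {K : Set V} (hK : IsCompact K)
    {φ : V → ℝ} (hφ : Continuous φ) (hφs : ∀ (c : ℝ) x, φ (c • x) = c * φ x)
    (hφK : ∀ x ∈ convexHull ℝ K, φ x = 1) :
    IsClosed {y : V | ∃ c : ℝ, 0 ≤ c ∧ ∃ x ∈ convexHull ℝ K, y = c • x} := by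
  set S := {y : V | ∃ c : ℝ, 0 ≤ c ∧ ∃ x ∈ convexHull ℝ K, y = c • x}
  refine isClosed_of_closure_subset fun y hy => ?_
  let B := (fun p : ℝ × V => p.1 • p.2) '' (Set.Icc 0 (φ y + 1) ×ˢ convexHull ℝ K)
  have hB : IsCompact B := (isCompact_Icc.prod (isCompact_convexHull hK)).image (by fun_prop)
  have hy' : y ∈ closure ({z | φ z < φ y + 1} ∩ S) :=
    (isOpen_lt hφ continuous_const).inter_closure ⟨by simp, hy⟩
  have hsub : {z | φ z < φ y + 1} ∩ S ⊆ B := by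
    rintro z ⟨hz, c, hc, x, hx, rfl⟩
    have hz : φ (c • x) < φ y + 1 := hz
    rw [hφs, hφK x hx, mul_one] at hz
    exact ⟨(c, x), ⟨⟨hc, hz.le⟩, hx⟩, rfl⟩
  obtain ⟨⟨c, x⟩, ⟨hc, hx⟩, rfl⟩ := closure_minimal hsub hB.isClosed hy'
  exact ⟨c, hc.1, x, hx, rfl⟩

end Convex

/-! ### Separability and block positive functionals -/

section Separable

variable {k n : ℕ}

/-- A functional on `M_k ⊗ M_n` is block positive if it is nonnegative on the products `A ⊗ B` of
positive semidefinite matrices; these functionals form the dual cone of the separable matrices. -/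
def IsBlockPositive (g : TMat k n →ₗ[ℂ] ℂ) : Prop :=
  ∀ (A : Mat k) (B : Mat n), A.PosSemidef → B.PosSemidef → 0 ≤ g (A ⊗ₖ B)

instance : LocallyConvexSpace ℝ (TMat k n) :=
  inferInstanceAs (LocallyConvexSpace ℝ (Fin k × Fin n → Fin k × Fin n → ℂ))

theorem isClosed_isSeparable : IsClosed {X : TMat k n | IsSeparable X} :=
  isClosed_closedConvexHull

theorem IsSeparable.of_kronecker {A : Mat k} {B : Mat n} (hA : A.PosSemidef) (hB : B.PosSemidef) :
    IsSeparable (A ⊗ₖ B) :=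
  subset_closedConvexHull ⟨A, B, hA, hB, rfl⟩

theorem IsSeparable.posSemidef {X : TMat k n} (hX : IsSeparable X) : X.PosSemidef := by
  refine closedConvexHull_min (t := {X : TMat k n | X.PosSemidef}) ?_ ?_ isClosed_posSemidef hX
  · rintro _ ⟨A, B, hA, hB, rfl⟩
    exact hA.kronecker hB
  · intro X hX Y hY a b ha hb _
    exact (hX.smul ha).add (hY.smul hb)

theorem IsSeparable.nonneg {X : TMat k n} (hX : IsSeparable X) {g : TMat k n →ₗ[ℂ] ℂ}
    (hg : IsBlockPositive g) : 0 ≤ g X := by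
  refine closedConvexHull_min (t := {X : TMat k n | 0 ≤ g X}) ?_ ?_ ?_ hX
  · rintro _ ⟨A, B, hA, hB, rfl⟩
    exact hg A B hA hB
  · intro X hX Y hY a b ha hb _
    change 0 ≤ g (a • X + b • Y)
    rw [map_add, LinearMap.map_smul_of_tower, LinearMap.map_smul_of_tower]
    exact add_nonneg (smul_nonneg ha hX) (smul_nonneg hb hY)
  · exact isClosed_le continuous_const g.continuous_of_finiteDimensional

/-- The block positive functionals detect separability. The separating real functional given by the
Hahn-Banach theorem is made invariant under `X ↦ Xᴴ`, so that its complexification is real, hence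
nonnegative, on products of positive semidefinite matrices. -/
theorem IsSeparable.of_forall_nonneg {X : TMat k n} (hX : X.IsHermitian)
    (h : ∀ g : TMat k n →ₗ[ℂ] ℂ, IsBlockPositive g → 0 ≤ (g X).re) : IsSeparable X := by
  by_contra hsep
  obtain ⟨f, u, hfX, hf⟩ :=
    geometric_hahn_banach_point_closed convex_closedConvexHull isClosed_closedConvexHull hsep
  have hu : u < 0 := by
    simpa using hf 0 (subset_closedConvexHull ⟨0, 0, .zero, .zero, by simp⟩)
  have hpos : ∀ (A : Mat k) (B : Mat n), A.PosSemidef → B.PosSemidef → 0 ≤ f (A ⊗ₖ B) := by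
    intro A B hA hB
    by_contra! hneg
    have hc : 0 ≤ u / f (A ⊗ₖ B) := (div_pos_of_neg_of_neg hu hneg).le
    have := hf _ (subset_closedConvexHull ⟨(u / f (A ⊗ₖ B)) • A, B, hA.smul hc, hB, rfl⟩)
    rw [Matrix.smul_kronecker, map_smul, smul_eq_mul, div_mul_cancel₀ _ hneg.ne] at this
    exact lt_irrefl _ this
  let f₁ : Module.Dual ℝ (TMat k n) :=
    (2⁻¹ : ℝ) • (f.toLinearMap + f.toLinearMap ∘ₗ
      { toFun := fun Y => Yᴴ
        map_add' := Matrix.conjTranspose_add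
        map_smul' := fun c Y => by simp [Matrix.conjTranspose_smul] })
  have hf₁ : ∀ Y, f₁ Y = 2⁻¹ * (f Y + f Yᴴ) := fun Y => rfl
  have hher : ∀ Y : TMat k n, Y.IsHermitian → f₁.extendRCLike (𝕜 := ℂ) Y = f Y := by
    intro Y hY
    have hI : (RCLike.I (K := ℂ) • Y)ᴴ = -(RCLike.I (K := ℂ) • Y) := by
      rw [Matrix.conjTranspose_smul, hY.eq]
      simp
    rw [Module.Dual.extendRCLike_apply, hf₁, hf₁, hI, hY.eq, map_neg]
    simp
    ring
  have := h (f₁.extendRCLike (𝕜 := ℂ)) fun A B hA hB => by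
    rw [hher _ (hA.kronecker hB).isHermitian]
    exact_mod_cast hpos A B hA hB
  rw [hher X hX, Complex.ofReal_re] at this
  linarith

theorem IsSeparable.smul_add {X Y : TMat k n} (hX : IsSeparable X) (hY : IsSeparable Y) {c : ℝ}
    (hc : 0 ≤ c) : IsSeparable (c • X + Y) := by
  refine .of_forall_nonneg ((hX.posSemidef.smul hc).add hY.posSemidef).isHermitian fun g hg => ?_
  rw [map_add, LinearMap.map_smul_of_tower]
  exact (Complex.nonneg_iff.1
    (add_nonneg (smul_nonneg hc (hX.nonneg hg)) (hY.nonneg hg))).1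

theorem IsSeparable.ampl {X : TMat k n} (hX : IsSeparable X) {S : Lin n} (hS : IsPositiveMap S) :
    IsSeparable (ampl k S X) := by
  have hcont : Continuous (MatrixMapCones.ampl k S) :=
    LinearMap.continuous_of_finiteDimensional _
  refine closedConvexHull_min (t := {X | IsSeparable (MatrixMapCones.ampl k S X)}) ?_ ?_
    (isClosed_isSeparable.preimage hcont) hX
  · rintro _ ⟨A, B, hA, hB, rfl⟩
    change IsSeparable _
    rw [ampl_kronecker]
    exact .of_kronecker hA (hS B hB)
  · intro X hX Y hY a b ha hb hab
    change IsSeparable (MatrixMapCones.ampl k S (a • X + b • Y))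
    rw [map_add, LinearMap.map_smul_of_tower, LinearMap.map_smul_of_tower]
    exact convex_closedConvexHull hX hY ha hb hab

end Separable

/-! ### Ampliations -/

section Ampl

variable {k n : ℕ}

theorem ampl_apply (S : Lin n) (X : TMat k n) (p q : Fin k × Fin n) :
    ampl k S X p q = S (Matrix.of fun i j => X (p.1, i) (q.1, j)) p.2 q.2 := rfl

theorem ampl_smul_add (c : ℝ) (S T : Lin n) (X : TMat k n) :
    ampl k (c • S + T) X = c • ampl k S X + ampl k T X := rfl

theorem continuous_eval (X : Mat n) : Continuous fun S : Lin n => S X :=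
  (continuous_apply X).comp continuous_induced_dom

theorem continuous_ampl (X : TMat k n) : Continuous fun S : Lin n => ampl k S X := by
  refine continuous_pi fun p => continuous_pi fun q => ?_
  exact ((continuous_eval _).matrix_elem p.2 q.2)

theorem ampl_isHermitian {S : Lin n} (hS : S ∈ LinHer n) {X : TMat k n} (hX : X.IsHermitian) :
    (ampl k S X).IsHermitian := by
  refine Matrix.ext fun p q => ?_
  rw [Matrix.conjTranspose_apply, ampl_apply, ampl_apply, ← Matrix.conjTranspose_apply, ← hS]
  exact congrArg (fun M => S M p.2 q.2) (Matrix.ext fun i j => hX.apply _ _)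

/-- The `k`-positivity of a `k`-entanglement breaking map is automatic, as separable matrices are
positive semidefinite. -/
theorem isKEntanglementBreaking_iff {S : Lin n} :
    IsKEntanglementBreaking k S ↔ ∀ X : TMat k n, X.PosSemidef → IsSeparable (ampl k S X) :=
  ⟨fun h => h.2, fun h => ⟨fun X hX => (h X hX).posSemidef, h⟩⟩

theorem IsPositiveMap.comp_isKEntanglementBreaking {P S : Lin n} (hP : IsPositiveMap P)
    (hS : IsKEntanglementBreaking k S) : IsKEntanglementBreaking k (P ∘ₗ S) :=
  isKEntanglementBreaking_iff.2 fun X hX => (hS.2 X hX).ampl hP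

/-- The compression of a positive semidefinite block matrix by `1 ⊗ y`. -/
theorem posSemidef_compress {X : TMat k n} (hX : X.PosSemidef) (y : Fin n → ℂ) :
    (Matrix.of fun i j : Fin k =>
      star y ⬝ᵥ ((Matrix.of fun a b => X (i, a) (j, b)) *ᵥ y)).PosSemidef := by
  let M : Matrix (Fin k × Fin n) (Fin k) ℂ := Matrix.of fun p j => if p.1 = j then y p.2 else 0
  convert hX.conjTranspose_mul_mul_same M using 1
  ext i j
  simp [M, Matrix.mul_apply, Fintype.sum_prod_type, dotProduct, Matrix.mulVec, apply_ite star,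
    Finset.mul_sum, Finset.sum_mul, mul_assoc]
  exact Finset.sum_comm

theorem posSemidef_trace_mul {X : TMat k n} (hX : X.PosSemidef) {A : Mat n} (hA : A.PosSemidef) :
    (Matrix.of fun i j : Fin k =>
      (A * (Matrix.of fun a b => X (i, a) (j, b))).trace).PosSemidef := by
  obtain ⟨N, rfl⟩ := exists_eq_conjTranspose_mul_self hA
  have : (Matrix.of fun i j : Fin k =>
      ((Nᴴ * N) * (Matrix.of fun a b => X (i, a) (j, b))).trace) =
      ∑ c, Matrix.of fun i j : Fin k =>
        star (star (N c)) ⬝ᵥ ((Matrix.of fun a b => X (i, a) (j, b)) *ᵥ star (N c)) := by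
    ext i j
    rw [Matrix.sum_apply, Matrix.of_apply, Matrix.mul_assoc, Matrix.trace_mul_comm,
      Matrix.mul_assoc]
    simp only [star_star]
    rfl
  rw [this]
  exact Matrix.posSemidef_sum _ fun c _ => posSemidef_compress hX _

theorem isKEntanglementBreaking_measurePrepare {A B : Mat n} (hA : A.PosSemidef)
    (hB : B.PosSemidef) : IsKEntanglementBreaking k (measurePrepare A B) :=
  isKEntanglementBreaking_iff.2 fun _ hX => .of_kronecker (posSemidef_trace_mul hX hA) hB

end Ampl

/-! ### The Hilbert-Schmidt inner product -/

section HilbertSchmidt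

variable {n : ℕ}

theorem hsInner_conj_symm (R S : Lin n) : hsInner R S = star (hsInner S R) := by
  simp only [hsInner_eq_sum, star_sum]
  refine Finset.sum_congr rfl fun i _ => Finset.sum_congr rfl fun j _ => ?_
  rw [← Matrix.trace_conjTranspose, Matrix.conjTranspose_mul, Matrix.conjTranspose_conjTranspose]

theorem hsAdjoint_comp (R S : Lin n) : hsAdjoint (R ∘ₗ S) = hsAdjoint S ∘ₗ hsAdjoint R := by
  ext1 A
  rw [← Matrix.conjTranspose_inj, Matrix.ext_iff_trace_mul_right]
  intro B
  rw [LinearMap.comp_apply, hsAdjoint_spec, hsAdjoint_spec, hsAdjoint_spec, LinearMap.comp_apply]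

theorem hsAdjoint_mem_linHer {S : Lin n} (hS : S ∈ LinHer n) : hsAdjoint S ∈ LinHer n := by
  intro A
  rw [← Matrix.conjTranspose_inj, Matrix.ext_iff_trace_mul_right]
  intro B
  have h := hsAdjoint_spec S A Bᴴ
  rw [hS, ← Matrix.conjTranspose_mul, Matrix.trace_conjTranspose,
    ← star_inj, star_star, ← Matrix.trace_conjTranspose] at h
  rw [hsAdjoint_spec]
  simp only [Matrix.conjTranspose_mul, Matrix.conjTranspose_conjTranspose] at h ⊢
  rw [Matrix.trace_mul_comm, ← h, Matrix.trace_mul_comm]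

/-- `⟨S, Tr(A ·) B⟩ = Tr(A S*(B))`. -/
theorem hsInner_measurePrepare (S : Lin n) (A B : Mat n) :
    hsInner S (measurePrepare A B) = (A * hsAdjoint S B).trace := by
  have : hsAdjoint S ∘ₗ measurePrepare A B =
      (Matrix.traceLinearMap (Fin n) ℂ ℂ ∘ₗ LinearMap.mulLeft ℂ A).smulRight (hsAdjoint S B) := by
    ext1 X
    simp
  rw [hsInner, this, LinearMap.trace_smulRight]
  rfl

theorem hsInner_measurePrepare_re (S : Lin n) {A B : Mat n} (hA : A.IsHermitian)
    (hB : B.IsHermitian) : (hsInner S (measurePrepare A B)).re = (S A * B).trace.re := by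
  have h := hsAdjoint_spec S B A
  rw [hsInner_measurePrepare, Matrix.trace_mul_comm (S A), ← hB.eq, ← h, hB.eq]
  rw [← Complex.conj_re, starRingEnd_apply, ← Matrix.trace_conjTranspose, Matrix.conjTranspose_mul,
    hA.eq]

theorem continuous_hsInner (S : Lin n) : Continuous fun R : Lin n => hsInner R S := by
  simp only [hsInner_eq_sum]
  refine continuous_finsetSum _ fun i _ => continuous_finsetSum _ fun j _ => ?_
  exact ((continuous_eval _).matrix_conjTranspose.matrix_mul continuous_const).matrix_trace

theorem hsInner_smul_add_re (c : ℝ) (R R' S : Lin n) :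
    (hsInner (c • R + R') S).re = c * (hsInner R S).re + (hsInner R' S).re := by
  simp [hsInner_eq_sum, Matrix.add_mul, Finset.sum_add_distrib, Finset.mul_sum,
    Matrix.conjTranspose_smul]

end HilbertSchmidt

variable {n k : ℕ}

/-! ### The cone of `k`-superpositive maps is closed -/

/-- The map `X ↦ Lᴴ X L`. -/
def krausMap (L : Mat n) : Lin n := LinearMap.mulRight ℂ L ∘ₗ LinearMap.mulLeft ℂ Lᴴ

@[simp]
theorem krausMap_apply (L X : Mat n) : krausMap L X = Lᴴ * X * L := rfl

theorem continuous_krausMap : Continuous (krausMap : Mat n → Lin n) := by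
  refine continuous_induced_rng.2 (continuous_pi fun X => ?_)
  exact (continuous_id.matrix_conjTranspose.matrix_mul continuous_const).matrix_mul continuous_id

theorem krausMap_smul (c : ℝ) (L : Mat n) : krausMap (c • L) = (c * c) • krausMap L := by
  ext1 X
  simp [Matrix.conjTranspose_smul, smul_smul]

theorem isKSuperpositive_iff {S : Lin n} : IsKSuperpositive k S ↔
    ∃ (p : ℕ) (L : Fin p → Mat n), (∀ i, (L i).rank ≤ k) ∧ S = ∑ i, krausMap (L i) := by
  refine exists_congr fun p => exists_congr fun L => and_congr_right fun _ => ?_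
  rw [LinearMap.ext_iff]
  simp [LinearMap.sum_apply]

theorem isClosed_rank_le : IsClosed {L : Mat n | L.rank ≤ k} := by
  let e : Mat n →ₗ[ℂ] (Fin n → ℂ) →L[ℂ] (Fin n → ℂ) :=
    LinearMap.toContinuousLinearMap.toLinearMap ∘ₗ Matrix.toLin'.toLinearMap
  have he : Continuous e := e.continuous_of_finiteDimensional
  have h := (isOpen_setOfPred_nat_le_rank (𝕜 := ℂ) (E := Fin n → ℂ) (F := Fin n → ℂ)
    (k + 1)).preimage he
  convert h.isClosed_compl using 1
  ext L
  have : (e L : (Fin n → ℂ) →ₗ[ℂ] (Fin n → ℂ)) = L.mulVecLin := rfl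
  simp only [Set.mem_compl_iff, Set.mem_preimage, Set.mem_ofPred_eq, this, Matrix.rank]
  rw [LinearMap.rank, ← Module.finrank_eq_rank, Nat.cast_le]
  omega

theorem trace_conjTranspose_mul_self_re (L : Mat n) :
    (Lᴴ * L).trace.re = ∑ j, ∑ i, ‖L i j‖ ^ 2 := by
  simp only [Matrix.trace, Matrix.diag_apply, Matrix.mul_apply, Matrix.conjTranspose_apply,
    Complex.re_sum]
  refine Finset.sum_congr rfl fun j _ => Finset.sum_congr rfl fun i _ => ?_
  rw [← Complex.normSq_eq_norm_sq, Complex.star_def, ← Complex.normSq_eq_conj_mul_self,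
    Complex.ofReal_re]

/-- The maps `X ↦ Lᴴ X L` with `L` of rank at most `k` and of Hilbert-Schmidt norm `1`. -/
def normalizedKrausMaps (n k : ℕ) : Set (Lin n) :=
  krausMap '' {L | L.rank ≤ k ∧ (Lᴴ * L).trace.re = 1}

theorem isCompact_normalizedKrausMaps : IsCompact (normalizedKrausMaps n k) := by
  refine IsCompact.image ?_ continuous_krausMap
  have hball : IsCompact (Set.univ.pi fun _ : Fin n => Set.univ.pi fun _ : Fin n =>
      Metric.closedBall (0 : ℂ) 1) :=
    isCompact_univ_pi fun _ => isCompact_univ_pi fun _ => isCompact_closedBall 0 1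
  refine hball.of_isClosed_subset (isClosed_rank_le.inter (isClosed_eq ?_ continuous_const)) ?_
  · exact Complex.continuous_re.comp
      (continuous_id.matrix_conjTranspose.matrix_mul continuous_id).matrix_trace
  · intro (L : Mat n) ⟨_, hL⟩ i _ j _
    rw [mem_closedBall_zero_iff, ← sq_le_one_iff₀ (norm_nonneg _), ← hL,
      trace_conjTranspose_mul_self_re]
    exact (Finset.single_le_sum (f := fun i => ‖L i j‖ ^ 2) (fun _ _ => by positivity)
      (Finset.mem_univ i)).trans
      (Finset.single_le_sum (f := fun j => ∑ i, ‖L i j‖ ^ 2) (fun _ _ => by positivity)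
        (Finset.mem_univ j))

theorem normalizedKrausMaps_nonempty (hk : 1 ≤ k) (hn : 1 ≤ n) :
    (normalizedKrausMaps n k).Nonempty := by
  refine ⟨_, Matrix.single ⟨0, hn⟩ ⟨0, hn⟩ 1, ⟨?_, ?_⟩, rfl⟩
  · rw [Matrix.single_eq_single_vecMulVec_single]
    exact (Matrix.rank_vecMulVec_le _ _).trans hk
  · simp

/-- For `L = 0` any normalized map serves as `x`, which is why the set must be nonempty. -/
theorem exists_krausMap_eq_smul (hk : 1 ≤ k) (hn : 1 ≤ n) {L : Mat n} (hL : L.rank ≤ k) :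
    ∃ x ∈ normalizedKrausMaps n k, krausMap L = (Lᴴ * L).trace.re • x := by
  have ht := (Complex.nonneg_iff.1 (Matrix.posSemidef_conjTranspose_mul_self L).trace_nonneg).1
  rcases ht.eq_or_lt with h0 | hpos
  · obtain ⟨x, hx⟩ := normalizedKrausMaps_nonempty hk hn
    have hL0 : L = 0 := by
      rw [← Matrix.trace_conjTranspose_mul_self_eq_zero_iff]
      exact Complex.ext h0.symm (Complex.nonneg_iff.1
        (Matrix.posSemidef_conjTranspose_mul_self L).trace_nonneg).2.symm
    refine ⟨x, hx, ?_⟩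
    rw [← h0, zero_smul, hL0]
    ext1 X
    simp
  · set t := (Lᴴ * L).trace.re
    have hs : √t * √t = t := Real.mul_self_sqrt ht
    have hs0 : √t ≠ 0 := (Real.sqrt_pos.2 hpos).ne'
    refine ⟨krausMap ((√t)⁻¹ • L), ⟨_, ⟨?_, ?_⟩, rfl⟩, ?_⟩
    · have : (√t)⁻¹ • L = L * Matrix.diagonal fun _ => (((√t)⁻¹ : ℝ) : ℂ) := by
        ext i j
        simp [mul_comm]
      rw [this]
      exact (Matrix.rank_mul_le_left _ _).trans hL
    · rw [Matrix.conjTranspose_smul, Matrix.smul_mul, Matrix.mul_smul, Matrix.trace_smul,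
        Matrix.trace_smul, Complex.smul_re, Complex.smul_re, smul_eq_mul, smul_eq_mul]
      change star (√t)⁻¹ * ((√t)⁻¹ * t) = 1
      rw [star_trivial]
      field_simp
      rw [sq, hs]
    · rw [krausMap_smul, smul_smul]
      have : t * ((√t)⁻¹ * (√t)⁻¹) = 1 := by
        field_simp
        rw [sq, hs]
      rw [this, one_smul]

theorem isCone_coneS : IsCone (coneS n k) := by
  rintro S hS T hT α hα
  obtain ⟨p, L, hL, rfl⟩ := isKSuperpositive_iff.1 hS
  obtain ⟨q, M, hM, rfl⟩ := isKSuperpositive_iff.1 hT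
  refine isKSuperpositive_iff.2 ⟨p + q, Fin.append (fun i => √α • L i) M, fun i => ?_, ?_⟩
  · induction i using Fin.addCases with
    | left i =>
      have : √α • L i = L i * Matrix.diagonal fun _ => ((√α : ℝ) : ℂ) := by
        ext a b
        simp [mul_comm]
      rw [Fin.append_left, this]
      exact (Matrix.rank_mul_le_left _ _).trans (hL i)
    | right i => simpa using hM i
  · rw [Fin.sum_univ_add]
    simp [krausMap_smul, Real.mul_self_sqrt hα, Finset.smul_sum]

theorem zero_mem_coneS : (0 : Lin n) ∈ coneS n k :=
  isKSuperpositive_iff.2 ⟨0, Fin.elim0, fun i => i.elim0, by simp⟩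

theorem coneS_eq (hk : 1 ≤ k) (hn : 1 ≤ n) : coneS n k =
    {S | ∃ c : ℝ, 0 ≤ c ∧ ∃ x ∈ convexHull ℝ (normalizedKrausMaps n k), S = c • x} := by
  ext S
  constructor
  · intro hS
    obtain ⟨p, L, hL, rfl⟩ := isKSuperpositive_iff.1 hS
    choose x hx hLx using fun i => exists_krausMap_eq_smul hk hn (hL i)
    have ht : ∀ i, 0 ≤ ((L i)ᴴ * L i).trace.re := fun i =>
      (Complex.nonneg_iff.1 (Matrix.posSemidef_conjTranspose_mul_self (L i)).trace_nonneg).1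
    simp_rw [hLx]
    set t := fun i => ((L i)ᴴ * L i).trace.re
    rcases (Finset.sum_nonneg fun i _ => ht i : 0 ≤ ∑ i, t i).eq_or_lt with h0 | hpos
    · obtain ⟨y, hy⟩ := normalizedKrausMaps_nonempty (n := n) hk hn
      refine ⟨0, le_rfl, y, subset_convexHull ℝ _ hy, ?_⟩
      rw [zero_smul]
      refine Finset.sum_eq_zero fun i hi => ?_
      have hti : t i = 0 := (Finset.sum_eq_zero_iff_of_nonneg fun i _ => ht i).1 h0.symm i hi
      change t i • x i = 0
      rw [hti, zero_smul]
    · refine ⟨∑ i, t i, hpos.le, Finset.univ.centerMass t x,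
        (convex_convexHull ℝ _).centerMass_mem (fun i _ => ht i) hpos
          fun i _ => subset_convexHull ℝ _ (hx i), ?_⟩
      rw [Finset.centerMass, smul_inv_smul₀ hpos.ne']
  · rintro ⟨c, hc, x, hx, rfl⟩
    have hsub : convexHull ℝ (normalizedKrausMaps n k) ⊆ coneS n k := by
      refine convexHull_min ?_ ?_
      · rintro _ ⟨L, hL, rfl⟩
        exact isKSuperpositive_iff.2 ⟨1, fun _ => L, fun _ => hL.1, by simp⟩
      · intro S hS T hT a b ha hb _
        have h := isCone_coneS _ hT _ zero_mem_coneS b hb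
        rw [add_zero] at h
        exact isCone_coneS _ hS _ h a ha
    simpa using isCone_coneS _ (hsub hx) _ zero_mem_coneS c hc

theorem isClosed_coneS (hk : 1 ≤ k) (hn : 1 ≤ n) : IsClosed (coneS n k) := by
  rw [coneS_eq hk hn]
  let φ : Lin n →ₗ[ℝ] ℝ := Complex.reLm ∘ₗ
    ((Matrix.traceLinearMap (Fin n) ℂ ℂ ∘ₗ LinearMap.applyₗ (1 : Mat n)).restrictScalars ℝ)
  have hφ : Continuous φ := Complex.continuous_re.comp (continuous_eval 1).matrix_trace
  refine isClosed_cone_of_compact isCompact_normalizedKrausMaps hφ (fun c x => map_smul φ c x) ?_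
  refine convexHull_min (t := {x | φ x = 1}) ?_ (convex_hyperplane φ.isLinear 1)
  rintro _ ⟨L, hL, rfl⟩
  change (Lᴴ * 1 * L).trace.re = 1
  rw [Matrix.mul_one]
  exact hL.2

/-! ### The dual cone of the `k`-entanglement breaking maps -/

theorem isCone_dualCone (C : Set (Lin n)) : IsCone (dualCone C) := by
  rintro R ⟨hR, hR'⟩ R₁ ⟨hR₁, hR₁'⟩ α hα
  refine ⟨(LinHer n).add_mem ((LinHer n).smul_mem α hR) hR₁, fun S hS => ?_⟩
  rw [hsInner_smul_add_re]
  exact add_nonneg (mul_nonneg hα (hR' S hS)) (hR₁' S hS)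

theorem isPositiveMap_of_mem_dualCone {R : Lin n} (hR : R ∈ dualCone (coneEB n k)) :
    IsPositiveMap R := by
  intro A hA
  refine posSemidef_of_forall_nonneg fun x => ?_
  have hx := Matrix.posSemidef_vecMulVec_self_star x
  have h := hR.2 _ (isKEntanglementBreaking_measurePrepare hA hx)
  rw [hsInner_measurePrepare_re R hA.isHermitian hx.isHermitian, trace_mul_vecMulVec_star] at h
  have hRA : (R A).IsHermitian := by rw [Matrix.IsHermitian, ← hR.1, hA.isHermitian.eq]
  exact Complex.nonneg_iff.2 ⟨h, (hRA.im_star_dotProduct_mulVec_self x).symm⟩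

theorem measurePrepare_mem_dualCone (hk : 1 ≤ k) {A B : Mat n} (hA : A.PosSemidef)
    (hB : B.PosSemidef) : measurePrepare A B ∈ dualCone (coneEB n k) := by
  refine ⟨(isKSuperpositive_measurePrepare hk hA hB).isPositiveMap.mem_linHer, fun S hS => ?_⟩
  rw [hsInner_conj_symm, Complex.star_def, Complex.conj_re,
    hsInner_measurePrepare_re S hA.isHermitian hB.isHermitian]
  exact (Complex.nonneg_iff.1 (trace_mul_nonneg (hS.1.isPositiveMap hk A hA) hB)).1

/-- For a functional `g` on `M_k ⊗ M_n` and a block matrix `X` with blocks `Xᵢⱼ`, the map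
`B ↦ ∑ᵢⱼ g(Eᵢⱼ ⊗ B) Xᵢⱼ`. It represents the functional `T ↦ g((Id ⊗ T)(X))` through the trace. -/
noncomputable def pairingMap (g : TMat k n →ₗ[ℂ] ℂ) (X : TMat k n) : Lin n :=
  ∑ i, ∑ j, (g ∘ₗ Matrix.kroneckerBilinear (R := ℂ) (α := ℂ)
    (Matrix.single i j 1)).smulRight (Matrix.of fun a b => X (i, a) (j, b))

theorem pairingMap_apply (g : TMat k n →ₗ[ℂ] ℂ) (X : TMat k n) (B : Mat n) :
    pairingMap g X B =
      ∑ i, ∑ j, g (Matrix.single i j 1 ⊗ₖ B) • Matrix.of fun a b => X (i, a) (j, b) := by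
  simp only [pairingMap, LinearMap.sum_apply]
  rfl

theorem trace_pairingMap_comp (g : TMat k n →ₗ[ℂ] ℂ) (X : TMat k n) (T : Lin n) :
    LinearMap.trace ℂ (Mat n) (pairingMap g X ∘ₗ T) = g (ampl k T X) := by
  have hX : ampl k T X = ∑ i, ∑ j,
      Matrix.single i j 1 ⊗ₖ T (Matrix.of fun a b => X (i, a) (j, b)) := by
    ext p q
    simp [Matrix.sum_apply, ampl_apply, Matrix.kroneckerMap_apply, Matrix.single_apply, ite_and]
  have hT : pairingMap g X ∘ₗ T = ∑ i, ∑ j, ((g ∘ₗ Matrix.kroneckerBilinear (R := ℂ) (α := ℂ)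
      (Matrix.single i j 1)) ∘ₗ T).smulRight (Matrix.of fun a b => X (i, a) (j, b)) := by
    ext1 Y
    simp only [LinearMap.comp_apply, pairingMap_apply, LinearMap.sum_apply]
    rfl
  rw [hT, hX]
  simp only [map_sum, LinearMap.trace_smulRight]
  rfl

/-- The quadratic form of `∑ᵢⱼ g(Eᵢⱼ ⊗ B) Xᵢⱼ` at `y` is the value of `g` at the product of the
compression of `X` by `1 ⊗ y` with `B`. -/
theorem isPositiveMap_pairingMap {g : TMat k n →ₗ[ℂ] ℂ} (hg : IsBlockPositive g) {X : TMat k n}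
    (hX : X.PosSemidef) : IsPositiveMap (pairingMap g X) := by
  intro B hB
  refine posSemidef_of_forall_nonneg fun y => ?_
  convert hg _ B (posSemidef_compress hX y) hB using 1
  set M : Mat k := Matrix.of fun i j =>
    star y ⬝ᵥ ((Matrix.of fun a b => X (i, a) (j, b)) *ᵥ y) with hM
  have hMB : M ⊗ₖ B = ∑ i, ∑ j, M i j • (Matrix.single i j (1 : ℂ) ⊗ₖ B) := by
    conv_lhs => rw [Matrix.matrix_eq_sum_single M]
    ext p q
    simp [Matrix.sum_apply, Matrix.kroneckerMap_apply, Matrix.single_apply, ite_and]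
  rw [hMB, pairingMap_apply]
  simp only [map_sum, map_smul, Matrix.sum_mulVec, Matrix.smul_mulVec, dotProduct_sum,
    dotProduct_smul, smul_eq_mul]
  exact Finset.sum_congr rfl fun i _ => Finset.sum_congr rfl fun j _ => mul_comm _ _

/-- If `S` is `k`-entanglement breaking and `R` lies in the dual cone, then `S ∘ R*` is
`k`-entanglement breaking: with `P` the positive map representing a test functional,
`Tr(P S R*) = Tr(R* P S) = ⟨R, P S⟩`, and `P S` is again `k`-entanglement breaking. -/
theorem comp_hsAdjoint_mem_coneEB (hk : 1 ≤ k) {S R : Lin n} (hS : S ∈ coneEB n k)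
    (hR : R ∈ dualCone (coneEB n k)) : S ∘ₗ hsAdjoint R ∈ coneEB n k := by
  refine isKEntanglementBreaking_iff.2 fun X hX => ?_
  have hher : S ∘ₗ hsAdjoint R ∈ LinHer n := fun Y => by
    rw [LinearMap.comp_apply, hsAdjoint_mem_linHer hR.1, (hS.1.isPositiveMap hk).mem_linHer]
    rfl
  refine .of_forall_nonneg (ampl_isHermitian hher hX.isHermitian) fun g hg => ?_
  rw [← trace_pairingMap_comp, ← LinearMap.comp_assoc, LinearMap.trace_comp_comm']
  exact hR.2 _ ((isPositiveMap_pairingMap hg hX).comp_isKEntanglementBreaking hS)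

theorem comp_mem_dualCone (hk : 1 ≤ k) {R T : Lin n} (hR : R ∈ dualCone (coneEB n k))
    (hT : T ∈ dualCone (coneEB n k)) : R ∘ₗ T ∈ dualCone (coneEB n k) := by
  refine ⟨fun X => ?_, fun S hS => ?_⟩
  · rw [LinearMap.comp_apply, hT.1, hR.1]
    rfl
  · have h := hR.2 _ (comp_hsAdjoint_mem_coneEB hk hS hT)
    rwa [hsInner, ← LinearMap.comp_assoc, LinearMap.trace_comp_comm', ← LinearMap.comp_assoc,
      ← hsAdjoint_comp] at h

theorem isClosed_dualCone (C : Set (Lin n)) : IsClosed (inHer (dualCone C)) := by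
  have : inHer (dualCone C) =
      ⋂ S ∈ C, {R : LinHer n | 0 ≤ (hsInner (R : Lin n) S).re} := by
    ext R
    simp only [Set.mem_iInter]
    exact ⟨fun h => h.2, fun h => ⟨R.2, h⟩⟩
  rw [this]
  exact isClosed_biInter fun S _ => isClosed_le continuous_const
    (Complex.continuous_re.comp ((continuous_hsInner S).comp continuous_subtype_val))

/-! ### The cones `P_k` and `EB_k` -/

theorem isCone_coneP : IsCone (coneP n k) := fun S hS T hT α hα X hX => by
  rw [ampl_smul_add]
  exact ((hS X hX).smul hα).add (hT X hX)

theorem isCone_coneEB : IsCone (coneEB n k) := fun S hS T hT α hα =>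
  isKEntanglementBreaking_iff.2 fun X hX => by
    rw [ampl_smul_add]
    exact (hS.2 X hX).smul_add (hT.2 X hX) hα

theorem isClosed_coneP : IsClosed (coneP n k) := by
  have : coneP n k = ⋂ (X : TMat k n) (_ : X.PosSemidef), {S | (ampl k S X).PosSemidef} := by
    ext S
    simp only [Set.mem_iInter]
    rfl
  rw [this]
  exact isClosed_biInter fun X _ => isClosed_posSemidef.preimage (continuous_ampl X)

theorem isClosed_coneEB : IsClosed (coneEB n k) := by
  have : coneEB n k = ⋂ (X : TMat k n) (_ : X.PosSemidef), {S | IsSeparable (ampl k S X)} := by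
    ext S
    simp only [Set.mem_iInter]
    exact isKEntanglementBreaking_iff
  rw [this]
  exact isClosed_biInter fun X _ => isClosed_isSeparable.preimage (continuous_ampl X)

theorem comp_mem_coneS {S T : Lin n} (hS : S ∈ coneS n k) (hT : T ∈ coneS n k) :
    S ∘ₗ T ∈ coneS n k := by
  obtain ⟨p, L, hL, rfl⟩ := isKSuperpositive_iff.1 hS
  obtain ⟨q, M, hM, rfl⟩ := isKSuperpositive_iff.1 hT
  refine isKSuperpositive_iff.2 ⟨p * q, fun r => M (finProdFinEquiv.symm r).2 *
    L (finProdFinEquiv.symm r).1, fun i => (Matrix.rank_mul_le_right _ _).trans (hL _), ?_⟩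
  rw [Equiv.sum_comp finProdFinEquiv.symm fun r => krausMap (M r.2 * L r.1),
    Fintype.sum_prod_type]
  ext1 X
  simp [LinearMap.sum_apply, Matrix.mul_assoc]

/-! ### Cones between the measure-and-prepare maps and the positive maps -/

theorem subset_linHer_of_forall_isPositiveMap {C : Set (Lin n)}
    (hpos : ∀ S ∈ C, IsPositiveMap S) : C ⊆ (LinHer n : Set (Lin n)) :=
  fun S hS => (hpos S hS).mem_linHer

theorem isPointed_of_forall_isPositiveMap {C : Set (Lin n)} (h0 : (0 : Lin n) ∈ C)
    (hpos : ∀ S ∈ C, IsPositiveMap S) : IsPointed (inHer C) := by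
  refine subset_antisymm (fun S hS => ?_) (Set.singleton_subset_iff.2 ⟨h0, ?_⟩)
  · exact Subtype.ext (eq_zero_of_isPositiveMap_neg (hpos _ hS.1) (hpos _ hS.2))
  · change ((-(0 : LinHer n) : LinHer n) : Lin n) ∈ C
    simpa using h0

theorem isSolid_of_measurePrepare_mem {C : Set (Lin n)} (h0 : (0 : Lin n) ∈ C)
    (hC : IsCone (inHer C))
    (hmp : ∀ A B : Mat n, A.PosSemidef → B.PosSemidef → measurePrepare A B ∈ C) :
    IsSolid (inHer C) := by
  let E : Set (LinHer n) :=
    {S | ∃ A B : Mat n, A.PosSemidef ∧ B.PosSemidef ∧ (S : Lin n) = measurePrepare A B}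
  refine hC.isSolid_of_span_eq_top (E := E) h0 ?_ (eq_top_iff.2 fun T _ => ?_)
  · rintro S ⟨A, B, hA, hB, hS⟩
    change (S : Lin n) ∈ C
    exact hS ▸ hmp A B hA hB
  · have hT := mem_span_measurePrepare T.2
    have hE : {S : Lin n | ∃ A B : Mat n, A.PosSemidef ∧ B.PosSemidef ∧ S = measurePrepare A B} =
        (LinHer n).subtype '' E := by
      ext S
      constructor
      · rintro ⟨A, B, hA, hB, rfl⟩
        exact ⟨⟨_, (isKSuperpositive_measurePrepare le_rfl hA hB).isPositiveMap.mem_linHer⟩,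
          ⟨A, B, hA, hB, rfl⟩, rfl⟩
      · rintro ⟨S, ⟨A, B, hA, hB, hS⟩, rfl⟩
        exact ⟨A, B, hA, hB, hS⟩
    rw [hE, ← Submodule.map_span] at hT
    obtain ⟨T', hT', hTT'⟩ := hT
    rwa [← Subtype.ext hTT']

/-- A closed cone of positive maps that is stable under composition and contains all maps
`X ↦ Tr(A X) B` with `A`, `B` positive semidefinite has all the required properties. -/
theorem cone_properties {C : Set (Lin n)} (hpos : ∀ S ∈ C, IsPositiveMap S)
    (hmp : ∀ A B : Mat n, A.PosSemidef → B.PosSemidef → measurePrepare A B ∈ C)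
    (hcone : IsCone C) (hclosed : IsClosed (inHer C))
    (hcomp : ∀ S ∈ C, ∀ T ∈ C, S ∘ₗ T ∈ C) :
    C ⊆ (LinHer n : Set (Lin n)) ∧
      IsCone (inHer C) ∧ IsClosed (inHer C) ∧ IsPointed (inHer C) ∧ IsSolid (inHer C) ∧
      ∀ S ∈ C, ∀ T ∈ C, S ∘ₗ T ∈ C := by
  have h0 : (0 : Lin n) ∈ C := by
    have h : measurePrepare (0 : Mat n) 0 = 0 := LinearMap.smulRight_zero _
    exact h ▸ hmp 0 0 .zero .zero
  have hcone' : IsCone (inHer C) := fun S hS T hT α hα => hcone S hS T hT α hα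
  exact ⟨subset_linHer_of_forall_isPositiveMap hpos, hcone', hclosed,
    isPointed_of_forall_isPositiveMap h0 hpos, isSolid_of_measurePrepare_mem h0 hcone' hmp, hcomp⟩

end MatrixMapCones

open MatrixMapCones in
theorem proposition4p1 (n k : ℕ) (hk : 1 ≤ k) (hkn : k ≤ n) (C : Set (Lin n))
    (hC : C = coneP n k ∨ C = coneS n k ∨ C = coneEB n k ∨ C = dualCone (coneEB n k)) :
    C ⊆ (LinHer n : Set (Lin n)) ∧
      IsCone (inHer C) ∧ IsClosed (inHer C) ∧ IsPointed (inHer C) ∧ IsSolid (inHer C) ∧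
      ∀ S ∈ C, ∀ T ∈ C, S ∘ₗ T ∈ C := by
  rcases hC with rfl | rfl | rfl | rfl
  · exact cone_properties (fun S hS => hS.isPositiveMap hk)
      (fun A B hA hB => (isKEntanglementBreaking_measurePrepare hA hB).1) isCone_coneP
      (isClosed_coneP.preimage continuous_subtype_val)
      fun S hS T hT X hX => hS _ (hT X hX)
  · exact cone_properties (fun S hS => hS.isPositiveMap)
      (fun A B hA hB => isKSuperpositive_measurePrepare hk hA hB) isCone_coneS
      ((isClosed_coneS hk (hk.trans hkn)).preimage continuous_subtype_val)
      fun S hS T hT => comp_mem_coneS hS hT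
  · exact cone_properties (fun S hS => hS.1.isPositiveMap hk)
      (fun A B hA hB => isKEntanglementBreaking_measurePrepare hA hB) isCone_coneEB
      (isClosed_coneEB.preimage continuous_subtype_val)
      fun S hS T hT => (hS.1.isPositiveMap hk).comp_isKEntanglementBreaking hT
  · exact cone_properties (fun R hR => isPositiveMap_of_mem_dualCone hR)
      (fun A B hA hB => measurePrepare_mem_dualCone hk hA hB) (isCone_dualCone _)
      (isClosed_dualCone _) fun R hR T hT => comp_mem_dualCone hk hR hT
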